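/- Let $\alpha,\eta,\theta,R$ be real $N\times N$ matrices with $\alpha=\alpha^{\mathrm T}>0$, $\eta=\eta^{\mathrm T}\ge 0$, $\theta^{\mathrm T}=-\theta$, $R=R^{\mathrm T}\ge 0$ and $N_R:=\operatorname{rank}R>0$, and consider the gyroscopic-dissipative system $\alpha\ddot Q+(2\theta+\beta R)\dot Q+\eta Q=0$ with loss parameter $\beta\ge 0$. Put $K_p=\sqrt{\alpha}^{\,-1}$, $K_q=\sqrt{\eta}$, $\Phi=K_qK_p^{\mathrm T}$ and let \[ A(\beta)=\Omega-\mathrm i\beta B,\qquad \Omega=\begin{bmatrix}-2\mathrm i K_p\theta K_p^{\mathrm T} & -\mathrm i\Phi^{\mathrm T}\\ \mathrm i\Phi & 0\end{bmatrix},\qquad B=\begin{bmatrix}K_pRK_p^{\mathrm T}&0\\0&0\end{bmatrix} \] be the system operator on $\mathbb C^{2N}$. The generic condition for the system says that the $N_R$ eigenvalues, counted with multiplicity, of $B_2=P_BBP_B|_{\operatorname{Ran}B}:\operatorname{Ran}B\to\operatorname{Ran}B$ are pairwise distinct, where $P_B$ is the orthogonal projection onto $\operatorname{Ran}B$ (equivalently,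 the nonzero eigenvalues of $\alpha^{-1}R$ are simple). If $\eta>0$, the dual system is the one obtained by interchanging $\alpha$ and $\eta$. Assume the duality condition $\eta>0$ and that the generic condition holds both for the system and for its dual. Then the eigenvalues of $A(\beta)$, counted with multiplicity, can be enumerated for all sufficiently large $\beta$ as $\zeta_1(\beta),\dots,\zeta_{2N}(\beta)$ in such a way that, as $\beta\to\infty$, \begin{align*} &|\zeta_j(\beta)|\to\infty, && 1\le j\le N_R \quad\text{(high-loss)},\\ &\zeta_j(\beta)\to 0, && N_R+1\le j\le 2N_R \quad\text{(low-loss/low-Q)},\\ &\zeta_j(\beta)\to\rho_j \text{ for some real } \rho_j\neq 0, && 2N_R+1\le j\le 2N \quad\text{(low-loss/high-Q)}, \end{align*} and every such enumeration has the following properties: \begin{enumerate} \item for all sufficiently large $\beta$, $\operatorname{Re}\zeta_j(\beta)=0$ for $1\le j\le N_R$; \item for all sufficiently large $\beta$, $\operatorname{Re}\zeta_j(\beta)\neq 0$ for $2N_R+1\le j\le 2N$; \item $\lim_{\beta\to\infty}\operatorname{Re}\zeta_j(\beta)=0$ for $N_R+1\le j\le 2N_R$; \item moreover, for all sufficiently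 large $\beta$, $\operatorname{Re}\zeta_j(\beta)=0$ for $N_R+1\le j\le 2N_R$. \end{enumerate} -/

import Mathlib

open Matrix Filter Topology
open scoped MatrixOrder

noncomputable section

/-- The data of the system `α Q'' + (2 θ + β R) Q' + η Q = 0` with `N` degrees of freedom
(the loss parameter `β` is kept as a variable). -/
structure LagrangianSystem (N : ℕ) where
  α : Matrix (Fin N) (Fin N) ℝ
  θ : Matrix (Fin N) (Fin N) ℝ
  η : Matrix (Fin N) (Fin N) ℝ
  R : Matrix (Fin N) (Fin N) ℝ
  posDef_α : α.PosDef
  skew_θ : θᵀ = -θ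
  posSemidef_η : η.PosSemidef
  posSemidef_R : R.PosSemidef
  rank_R_pos : 0 < R.rank

namespace LagrangianSystem

variable {N : ℕ}

/-- The dual system, obtained by interchanging `α` and `η`. It exists under the duality
condition `η > 0`. -/
def dual (S : LagrangianSystem N) (hη : S.η.PosDef) : LagrangianSystem N where
  α := S.η
  θ := S.θ
  η := S.α
  R := S.R
  posDef_α := hη
  skew_θ := S.skew_θ
  posSemidef_η := S.posDef_α.posSemidef
  posSemidef_R := S.posSemidef_R
  rank_R_pos := S.rank_R_pos

/-- The rank `N_R` of the loss matrix. -/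
def NR (S : LagrangianSystem N) : ℕ := S.R.rank

/-- `K_p = (√α)⁻¹`, with the positive definite square root. -/
def Kp (S : LagrangianSystem N) : Matrix (Fin N) (Fin N) ℝ := (CFC.sqrt S.α)⁻¹

/-- `K_q = √η`, with the positive semidefinite square root. -/
def Kq (S : LagrangianSystem N) : Matrix (Fin N) (Fin N) ℝ := CFC.sqrt S.η

/-- `Φ = K_q K_pᵀ`. -/
def Phi (S : LagrangianSystem N) : Matrix (Fin N) (Fin N) ℝ := S.Kq * S.Kpᵀ

/-- The frequency operator `Ω`, in the block form
`[[-2 i K_p θ K_pᵀ, -i Φᵀ], [i Φ, 0]]`. -/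
def Omega (S : LagrangianSystem N) : Matrix (Fin N ⊕ Fin N) (Fin N ⊕ Fin N) ℂ :=
  Matrix.fromBlocks
    ((-(2 * Complex.I)) • (S.Kp * S.θ * S.Kpᵀ).map Complex.ofReal)
    ((-Complex.I) • (S.Phiᵀ).map Complex.ofReal)
    (Complex.I • S.Phi.map Complex.ofReal)
    0

/-- The dissipation operator `B`, in the block form `[[K_p R K_pᵀ, 0], [0, 0]]`. -/
def B (S : LagrangianSystem N) : Matrix (Fin N ⊕ Fin N) (Fin N ⊕ Fin N) ℂ :=
  Matrix.fromBlocks ((S.Kp * S.R * S.Kpᵀ).map Complex.ofReal) 0 0 0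

/-- The system operator `A(β) = Ω - i β B`. -/
def A (S : LagrangianSystem N) (β : ℝ) : Matrix (Fin N ⊕ Fin N) (Fin N ⊕ Fin N) ℂ :=
  S.Omega - (Complex.I * (β : ℂ)) • S.B

/-- The operator `B` on the Hilbert space `ℂ^{2N}` with its standard inner product. -/
def Bop (S : LagrangianSystem N) :
    EuclideanSpace ℂ (Fin N ⊕ Fin N) →ₗ[ℂ] EuclideanSpace ℂ (Fin N ⊕ Fin N) :=
  Matrix.toEuclideanLin S.B

/-- The loss subspace `H_B = Ran B`. -/
def HB (S : LagrangianSystem N) : Submodule ℂ (EuclideanSpace ℂ (Fin N ⊕ Fin N)) :=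
  LinearMap.range S.Bop

/-- The compression `B₂ = P_B B P_B |_{H_B} : H_B → H_B` of `B` to the loss subspace, where
`P_B` is the orthogonal projection onto `H_B`. -/
def B2 (S : LagrangianSystem N) : S.HB →ₗ[ℂ] S.HB :=
  (S.HB.orthogonalProjectionOnto : EuclideanSpace ℂ (Fin N ⊕ Fin N) →ₗ[ℂ] S.HB) ∘ₗ
    S.Bop ∘ₗ S.HB.subtype

/-- The generic condition: the eigenvalues `b_1, …, b_{N_R}` of `B₂`, listed with
multiplicity, are pairwise distinct. -/
def Generic (S : LagrangianSystem N) : Prop := S.B2.charpoly.roots.Nodup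

/-- `ζ_1(β), …, ζ_{2N}(β)` is an enumeration of the eigenvalues of `A(β)`, counted with
multiplicity, for all large `β`, indexed by its behaviour as `β → ∞`: high-loss first, then
low-loss/low-Q, then low-loss/high-Q (whose limits are nonzero limiting frequencies `ρ`).
Indices start at `0`, so `1 ≤ j ≤ N_R` becomes `j < N_R`, and so on. -/
structure IsModalEnumeration (S : LagrangianSystem N) (ζ : Fin (2 * N) → ℝ → ℂ) : Prop where
  eigenvalues : ∀ᶠ β : ℝ in atTop,
    (S.A β).charpoly.roots = (Finset.univ : Finset (Fin (2 * N))).val.map (fun j => ζ j β)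
  high_loss : ∀ j : Fin (2 * N), (j : ℕ) < S.NR → Tendsto (fun β => ‖ζ j β‖) atTop atTop
  low_loss_low_Q : ∀ j : Fin (2 * N), S.NR ≤ (j : ℕ) → (j : ℕ) < 2 * S.NR →
    Tendsto (ζ j) atTop (𝓝 0)
  low_loss_high_Q : ∀ j : Fin (2 * N), 2 * S.NR ≤ (j : ℕ) →
    ∃ ρ : ℝ, ρ ≠ 0 ∧ Tendsto (ζ j) atTop (𝓝 (ρ : ℂ))

end LagrangianSystem

end

/-! For `z ≠ 0` the characteristic polynomial of `A β` is, up to a congruence normalizing `α`, the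
determinant of the pencil `z² α + i z (2θ + β R) - η`. Diagonalize `R` simultaneously with `α` and
divide by `β ^ N_R`: as `β → ∞` the determinant tends to a nonzero constant times `z ^ N_R` times
the determinant of the pencil compressed to the directions without loss
(`exists_tendsto_eval_charpoly_A`). That compressed pencil is undamped, with positive definite
stiffness, so its `2N - 2 N_R` frequencies are real and nonzero. Continuity of roots gives the three
groups: `N_R` roots escape because the degree drops, `N_R` tend to `0`, the rest to real nonzero
limits. This uses `η > 0` but not genericity, and claims 2 and 3 follow by taking real parts of
limits.

For exact vanishing of real parts put `z = i t`: a real nonzero zero of `det (t² α + t (2θ + β R) +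
η)` is a purely imaginary eigenvalue. After scaling `t = β s` the limiting zeros away from `0` are
minus the nonzero loss eigenvalues, simple by genericity, so sign changes produce `N_R` distinct
real zeros of size at least `c β` (`Generic.eventually_exists_large_zeros`). Only high-loss modes
can be that large, and there are at most `N_R` of them, so all are imaginary. The map `t ↦ 1/t`
exchanges `α` and `η` (`pencil_dual`), so large zeros of the dual become small zeros of the system,
which exhaust the low-Q modes in the same way. -/

noncomputable section

/-! ### Continuity of roots, including roots that escape to infinity -/

/-- Monic polynomials of degree `n`, given by their roots, that converge outside a finite set
converge everywhere. -/
lemma tendsto_prod_sub_of_notMem_finset {X : Type*} {l : Filter X} {n : ℕ} {s : X → Multiset ℂ}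
    (hs : ∀ x, (s x).card = n) {ρ : Multiset ℂ} (hρ : ρ.card = n) (F : Finset ℂ)
    (h : ∀ z ∉ F, Tendsto (fun x => ((s x).map (fun a => z - a)).prod) l
      (𝓝 ((ρ.map (fun a => z - a)).prod))) (z : ℂ) :
    Tendsto (fun x => ((s x).map (fun a => z - a)).prod) l
      (𝓝 ((ρ.map (fun a => z - a)).prod)) := by
  -- With `n + 1` nodes outside `F`, interpolation expresses the value at `z` as a fixed linear
  -- combination of the values at the nodes.
  obtain ⟨t, htF, ht⟩ := (F.finite_toSet.infinite_compl).exists_subset_card_eq (n + 1)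
  have key : ∀ m : Multiset ℂ, m.card = n → (m.map (fun a => z - a)).prod =
      ∑ i ∈ t, ((m.map (fun a => i - a)).prod) * (Lagrange.basis t id i).eval z := by
    intro m hm
    let p : Polynomial ℂ := (m.map (fun a => Polynomial.X - Polynomial.C a)).prod
    have hp : ∀ w, p.eval w = (m.map (fun a => w - a)).prod := by
      intro w
      simp [p, Polynomial.eval_multiset_prod, Multiset.map_map]
    have hd : p.degree < (t.card : WithBot ℕ) := by
      rw [ht]
      have h1 : p.natDegree = n := by
        simp [p, hm]
      have h2 : p ≠ 0 := (Polynomial.monic_multiset_prod_of_monic _ _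
        (fun a _ => Polynomial.monic_X_sub_C a)).ne_zero
      rw [Polynomial.degree_eq_natDegree h2, h1]
      exact_mod_cast Nat.lt_succ_self n
    have := Lagrange.eq_interpolate (s := t) (v := id) (Function.injective_id.injOn) hd
    rw [← hp, this, Lagrange.interpolate_apply, Polynomial.eval_finsetSum]
    refine Finset.sum_congr rfl fun i _ => ?_
    simp [hp]
  simp only [key _ (hs _), key _ hρ]
  refine tendsto_finsetSum _ fun i hi => (h i ?_).mul_const _
  exact fun hiF => htF hi hiF

/-- Continuity of roots: if monic polynomials of degree `n` converge pointwise (outside a finite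
set), their roots can be enumerated so as to converge to the roots of the limit. -/
lemma exists_tendsto_enumeration {X : Type*} {l : Filter X} (n : ℕ) (s : X → Multiset ℂ)
    (hs : ∀ x, (s x).card = n) (ρ : Fin n → ℂ) (F : Finset ℂ)
    (h : ∀ z ∉ F, Tendsto (fun x => ((s x).map (fun a => z - a)).prod) l
      (𝓝 (∏ j, (z - ρ j)))) :
    ∃ ζ : Fin n → X → ℂ, (∀ x, s x = Finset.univ.val.map (fun j => ζ j x)) ∧
      ∀ j, Tendsto (ζ j) l (𝓝 (ρ j)) := by
  classical
  induction n generalizing s F with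
  | zero =>
    exact ⟨fun j => j.elim0, fun x => by simpa using Multiset.card_eq_zero.mp (hs x),
      fun j => j.elim0⟩
  | succ n ih =>
    have h0 : Tendsto (fun x => ((s x).map (fun a => ρ 0 - a)).prod) l (𝓝 0) := by
      have := tendsto_prod_sub_of_notMem_finset hs
        (ρ := Finset.univ.val.map ρ) (by simp) F
        (fun z hz => by rw [Multiset.map_map]; exact h z hz) (ρ 0)
      rwa [Multiset.prod_eq_zero] at this
      exact Multiset.mem_map.mpr ⟨ρ 0,
        Multiset.mem_map_of_mem ρ (Finset.mem_univ (0 : Fin (n + 1))), sub_self _⟩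
    -- A root nearest to `ρ 0` converges to it: its distance to the power `n + 1` is at most the
    -- product of all distances, which tends to `0`.
    have hex : ∀ x, ∃ r ∈ s x, ∀ a ∈ s x, ‖ρ 0 - r‖ ≤ ‖ρ 0 - a‖ := by
      intro x
      have hne : (s x).toFinset.Nonempty := by
        rw [Finset.nonempty_iff_ne_empty, Ne, Multiset.toFinset_eq_empty]
        intro hx
        have := hs x
        simp [hx] at this
      obtain ⟨r, hr, hmin⟩ := (s x).toFinset.exists_min_image (fun a => ‖ρ 0 - a‖) hne
      exact ⟨r, by simpa using hr, fun a ha => hmin a (by simpa using ha)⟩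
    choose r hr hmin using hex
    have hrt : Tendsto r l (𝓝 (ρ 0)) := by
      have hle : ∀ x, ‖ρ 0 - r x‖ ^ (n + 1) ≤ ‖((s x).map (fun a => ρ 0 - a)).prod‖ := by
        intro x
        have h1 : ‖((s x).map (fun a => ρ 0 - a)).prod‖ =
            ((s x).map (fun a => ‖ρ 0 - a‖)).prod := by
          rw [← coe_nnnorm]
          simpa [Multiset.map_map, Function.comp_def] using
            map_multiset_prod (normHom : ℂ →*₀ ℝ) ((s x).map (fun a => ρ 0 - a))
        have h2 : ‖ρ 0 - r x‖ ^ (n + 1) = ((s x).map (fun _ => ‖ρ 0 - r x‖)).prod := by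
          rw [Multiset.map_const', Multiset.prod_replicate, hs x]
        rw [h1, h2]
        exact Multiset.prod_map_le_prod_map₀ _ _ (fun a _ => norm_nonneg _) (hmin x)
      have h2 : Tendsto (fun x => ‖ρ 0 - r x‖ ^ (n + 1)) l (𝓝 0) :=
        squeeze_zero (fun x => by positivity) hle (by simpa using h0.norm)
      have h3 : Tendsto (fun x => ‖ρ 0 - r x‖) l (𝓝 0) := by
        have := h2.rpow_const (p := ((n + 1 : ℕ) : ℝ)⁻¹) (Or.inr (by positivity))
        rw [Real.zero_rpow (by positivity)] at this
        refine this.congr fun x => ?_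
        exact Real.pow_rpow_inv_natCast (norm_nonneg _) (Nat.succ_ne_zero n)
      rw [tendsto_iff_norm_sub_tendsto_zero]
      simpa [norm_sub_rev] using h3
    -- Dividing out the factor `z - r x` preserves convergence except at `z = ρ 0`; this is why the
    -- statement allows an exceptional set.
    obtain ⟨ζ, hζ, hζt⟩ := ih (fun x => (s x).erase (r x))
      (fun x => by rw [Multiset.card_erase_of_mem (hr x), hs x]; rfl) (fun j => ρ j.succ)
      (insert (ρ 0) F) (by
        intro z hz
        simp only [Finset.mem_insert, not_or] at hz
        have h1 := (h z hz.2).div (tendsto_const_nhds.sub hrt) (sub_ne_zero.mpr hz.1)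
        rw [Fin.prod_univ_succ, mul_div_cancel_left₀ _ (sub_ne_zero.mpr hz.1)] at h1
        refine h1.congr' ?_
        have hne : ∀ᶠ x in l, r x ≠ z := hrt.eventually_ne (Ne.symm hz.1)
        filter_upwards [hne] with x hx
        rw [Pi.div_apply, div_eq_iff (sub_ne_zero.mpr (Ne.symm hx)), mul_comm]
        exact (Multiset.prod_map_erase (hr x)).symm)
    refine ⟨Fin.cons r ζ, fun x => ?_, fun j => ?_⟩
    · rw [← Multiset.cons_erase (hr x), hζ x, Fin.univ_succ]
      simp [Function.comp_def]
    · refine Fin.cases ?_ (fun j => ?_) j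
      · simpa using hrt
      · simpa using hζt j

/-- Continuity of roots when some of the roots escape to infinity: the polynomials with root
multisets `s x`, suitably rescaled, converge to a polynomial with roots `ρ j`, `j : κ`. -/
lemma exists_enumeration_of_tendsto {X ι κ : Type*} [Fintype ι] [Fintype κ] {l : Filter X}
    {s : X → Multiset ℂ} (hs : ∀ x, (s x).card = Fintype.card ι + Fintype.card κ)
    (ρ : κ → ℂ) {c : X → ℂ} {K : ℂ} (hK : K ≠ 0) {F : Finset ℂ} {q : ℂ} (hqF : q ∉ F)
    (hq : ∀ j, ρ j ≠ q)
    (h : ∀ z ∉ F, Tendsto (fun x => c x * ((s x).map (fun a => z - a)).prod) l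
      (𝓝 (K * ∏ j, (z - ρ j)))) :
    ∃ ζ : ι ⊕ κ → X → ℂ, (∀ x, s x = Finset.univ.val.map (fun j => ζ j x)) ∧
      (∀ i, Tendsto (fun x => ‖ζ (Sum.inl i) x‖) l atTop) ∧
      ∀ j, Tendsto (ζ (Sum.inr j)) l (𝓝 (ρ j)) := by
  classical
  let n := Fintype.card (ι ⊕ κ)
  let e : Fin n ≃ ι ⊕ κ := (Fintype.equivFin _).symm
  -- The inversion `a ↦ (a - q)⁻¹` sends escaping roots to `0`, reducing to the case where all roots
  -- converge.
  let ω : ι ⊕ κ → ℂ := Sum.elim (fun _ => 0) (fun j => (ρ j - q)⁻¹)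
  have hprod : ∀ (m : Multiset ℂ), q ∉ m → ∀ w : ℂ, w ≠ 0 →
      (m.map (fun a => w - (a - q)⁻¹)).prod =
        w ^ m.card * (m.map (fun a => (q + w⁻¹) - a)).prod / (m.map (fun a => q - a)).prod := by
    intro m hm w hw
    induction m using Multiset.induction_on with
    | empty => simp
    | cons a m ih =>
      simp only [Multiset.mem_cons, not_or] at hm
      have h1 : a - q ≠ 0 := sub_ne_zero.mpr (Ne.symm hm.1)
      have h2 : q - a ≠ 0 := sub_ne_zero.mpr hm.1
      simp only [Multiset.map_cons, Multiset.prod_cons, Multiset.card_cons, ih hm.2]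
      rw [mul_div_assoc', mul_comm (q - a) _, ← div_div]
      rw [eq_div_iff h2, div_mul_eq_mul_div]
      congr 1
      have : (w - (a - q)⁻¹) * (q - a) = w * (q + w⁻¹ - a) := by
        field_simp
        ring
      rw [pow_succ]
      linear_combination (w ^ m.card * (m.map (fun a => (q + w⁻¹) - a)).prod) * this
  have hQ : K * ∏ j, (q - ρ j) ≠ 0 :=
    mul_ne_zero hK (Finset.prod_ne_zero_iff.mpr fun j _ => sub_ne_zero.mpr (hq j).symm)
  have hne := (h q hqF).eventually_ne hQ
  have hsq : ∀ᶠ x in l, q ∉ s x := by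
    filter_upwards [hne] with x hx hqx
    refine hx ?_
    rw [Multiset.prod_eq_zero, mul_zero]
    exact Multiset.mem_map.mpr ⟨q, hqx, sub_self q⟩
  have hlim : ∀ w ∉ insert 0 (F.image (fun z => (z - q)⁻¹)),
      Tendsto (fun x => (((s x).map (fun a => (a - q)⁻¹)).map (fun a => w - a)).prod) l
      (𝓝 (∏ j, (w - ω (e j)))) := by
    intro w hw
    simp only [Finset.mem_insert, Finset.mem_image, not_or, not_exists, not_and] at hw
    obtain ⟨hw0, hwF⟩ := hw
    have hF : q + w⁻¹ ∉ F := fun hF => hwF _ hF (by simp)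
    -- Dividing by the value at `q` cancels the unknown scaling `c x` and the constant `K`.
    have h1 := ((h _ hF).div (h q hqF) hQ).const_mul (w ^ n)
    have h2 : w ^ n * ((K * ∏ j, (q + w⁻¹ - ρ j)) / (K * ∏ j, (q - ρ j))) =
        ∏ j, (w - ω (e j)) := by
      rw [e.prod_comp (fun j => w - ω j), Fintype.prod_sum_type]
      have := hprod (Finset.univ.val.map ρ) (by simpa using fun j => hq j) w hw0
      simp only [Multiset.map_map, Function.comp_def, Multiset.card_map] at this
      simp only [ω, Sum.elim_inl, Sum.elim_inr, sub_zero, Finset.prod_const]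
      change w ^ n * _ = _ * (Finset.univ.val.map fun j => w - (ρ j - q)⁻¹).prod
      rw [this]
      change _ = w ^ _ * (w ^ _ * (∏ j, (q + w⁻¹ - ρ j)) / ∏ j, (q - ρ j))
      have h3 : n = Fintype.card ι + Fintype.card κ := Fintype.card_sum
      rw [mul_div_mul_left _ _ hK, h3, pow_add]
      simp only [Finset.card_univ, Finset.card_val]
      ring
    rw [h2] at h1
    refine h1.congr' ?_
    filter_upwards [hne, hsq] with x hx hxq
    rw [Multiset.map_map]
    simp only [Function.comp_def]
    rw [hprod _ hxq w hw0, Pi.div_apply, mul_div_mul_left _ _ (left_ne_zero_of_mul hx), hs x]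
    simp only [n, Fintype.card_sum]
    ring
  obtain ⟨ξ, hξ, hξt⟩ := exists_tendsto_enumeration n
    (fun x => (s x).map (fun a => (a - q)⁻¹)) (fun x => by simp [hs, n]) (fun j => ω (e j)) _ hlim
  have hξ0 : ∀ j, ∀ᶠ x in l, ξ j x ≠ 0 := by
    intro j
    filter_upwards [hsq] with x hxq h0
    have : ξ j x ∈ (s x).map (fun a => (a - q)⁻¹) := by
      rw [hξ]
      exact Multiset.mem_map_of_mem _ (Finset.mem_univ j)
    rw [h0] at this
    obtain ⟨a, ha, ha0⟩ := Multiset.mem_map.mp this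
    rw [inv_eq_zero, sub_eq_zero] at ha0
    exact hxq (ha0 ▸ ha)
  refine ⟨fun j x => q + (ξ (e.symm j) x)⁻¹, fun x => ?_, fun i => ?_, fun j => ?_⟩
  · have h1 : s x = ((s x).map (fun a => (a - q)⁻¹)).map (fun w => q + w⁻¹) := by
      simp [Multiset.map_map]
    have h2 : (Finset.univ : Finset (ι ⊕ κ)).val = (Finset.univ : Finset (Fin n)).val.map e := by
      rw [← Finset.map_univ_equiv e]
      rfl
    rw [h1, hξ x, h2]
    simp only [Multiset.map_map, Function.comp_def, Equiv.symm_apply_apply]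
  · have h1 := hξt (e.symm (Sum.inl i))
    simp only [Equiv.apply_symm_apply, ω, Sum.elim_inl] at h1
    have h2 : Tendsto (fun x => ‖(ξ (e.symm (Sum.inl i)) x)⁻¹‖) l atTop := by
      refine tendsto_norm_inv_nhdsNE_zero_atTop.comp ?_
      exact tendsto_nhdsWithin_iff.mpr ⟨h1, hξ0 _⟩
    refine tendsto_atTop_mono (fun x => ?_) (tendsto_atTop_add_const_right _ (-‖q‖) h2)
    have := norm_sub_le (q + (ξ (e.symm (Sum.inl i)) x)⁻¹) q
    rw [add_sub_cancel_left] at this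
    linarith
  · have h1 := hξt (e.symm (Sum.inr j))
    simp only [Equiv.apply_symm_apply, ω, Sum.elim_inr] at h1
    have h2 := (h1.inv₀ (inv_ne_zero (sub_ne_zero.mpr (hq j)))).const_add q
    simpa using h2

/-! ### Persistence of simple real zeros -/

/-- Near a simple zero of the limit of continuous real functions, the functions eventually have
a zero. -/
lemma eventually_exists_zeros {X ι : Type*} [Finite ι] {l : Filter X} {f : X → ℝ → ℝ}
    {g : ℝ → ℝ} (hf : ∀ x, Continuous (f x)) (hfg : ∀ t, Tendsto (fun x => f x t) l (𝓝 (g t)))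
    {a : ι → ℝ} (ha : Function.Injective a) (ha0 : ∀ i, a i ≠ 0)
    (hg : ∀ i, ∃ k : ℝ → ℝ, ContinuousAt k (a i) ∧ k (a i) ≠ 0 ∧ ∀ t, g t = (t - a i) * k t) :
    ∃ c > 0, ∀ᶠ x in l, ∃ y : ι → ℝ, Function.Injective y ∧
      ∀ i, f x (y i) = 0 ∧ c ≤ |y i| := by
  have hlt : ∀ c : ℝ, 0 < c → ∀ᶠ δ : ℝ in 𝓝[>] 0, δ < c := fun c hc =>
    eventually_nhdsWithin_of_eventually_nhds (eventually_lt_nhds hc)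
  have hsign : ∀ i, ∀ᶠ δ : ℝ in 𝓝[>] 0, g (a i - δ) * g (a i + δ) < 0 := by
    intro i
    obtain ⟨k, hk, hk0, hgk⟩ := hg i
    have h1 : Tendsto (fun δ : ℝ => k (a i - δ) * k (a i + δ)) (𝓝[>] 0)
        (𝓝 (k (a i) * k (a i))) := by
      refine Tendsto.mono_left ?_ nhdsWithin_le_nhds
      refine Tendsto.mul (hk.tendsto.comp ?_) (hk.tendsto.comp ?_)
      · exact (by fun_prop : Continuous fun δ : ℝ => a i - δ).tendsto' _ _ (by simp)
      · exact (by fun_prop : Continuous fun δ : ℝ => a i + δ).tendsto' _ _ (by simp)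
    have h2 := h1.eventually_const_lt (mul_self_pos.mpr hk0)
    filter_upwards [h2, self_mem_nhdsWithin] with δ hδ hpos
    rw [hgk, hgk]
    have : 0 < δ * δ := mul_pos hpos hpos
    nlinarith [mul_pos this hδ]
  -- These bounds keep the intervals of radius `δ` around the zeros disjoint and at distance more
  -- than `δ` from `0`, so `δ` itself serves as the constant `c`.
  have hall : ∀ᶠ δ : ℝ in 𝓝[>] 0, 0 < δ ∧ (∀ i, g (a i - δ) * g (a i + δ) < 0) ∧
      (∀ i, δ < |a i| / 2) ∧ ∀ i j, a i ≠ a j → δ < |a i - a j| / 2 := by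
    refine Eventually.and self_mem_nhdsWithin (Eventually.and (eventually_all.mpr hsign)
      (Eventually.and (eventually_all.mpr fun i => hlt _ ?_)
      (eventually_all.mpr fun i => eventually_all.mpr fun j => ?_)))
    · have := abs_pos.mpr (ha0 i)
      positivity
    · by_cases hij : a i = a j
      · simp [hij]
      · have := abs_pos.mpr (sub_ne_zero.mpr hij)
        filter_upwards [hlt (|a i - a j| / 2) (by positivity)] with δ hδ _ using hδ
  obtain ⟨δ, hδ, hs, hδa, hδs⟩ := hall.exists
  refine ⟨δ, hδ, ?_⟩
  have hev : ∀ᶠ x in l, ∀ i, f x (a i - δ) * f x (a i + δ) < 0 :=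
    eventually_all.mpr fun i => ((hfg _).mul (hfg _)).eventually_lt_const (hs i)
  filter_upwards [hev] with x hx
  have hroot : ∀ i, ∃ y, |y - a i| ≤ δ ∧ f x y = 0 := by
    intro i
    have hle : a i - δ ≤ a i + δ := by linarith
    have hmem : (0 : ℝ) ∈ Set.uIcc (f x (a i - δ)) (f x (a i + δ)) := by
      rw [Set.mem_uIcc]
      rcases mul_neg_iff.mp (hx i) with h | h
      · exact Or.inr ⟨h.2.le, h.1.le⟩
      · exact Or.inl ⟨h.1.le, h.2.le⟩
    obtain ⟨y, hy, hy0⟩ := intermediate_value_uIcc (hf x).continuousOn hmem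
    rw [Set.uIcc_of_le hle] at hy
    exact ⟨y, abs_le.mpr ⟨by linarith [hy.1], by linarith [hy.2]⟩, hy0⟩
  choose y hy hy0 using hroot
  refine ⟨y, fun i j hij => ?_, fun i => ⟨hy0 i, ?_⟩⟩
  · by_contra hne
    have h1 := hδs i j (fun h => hne (ha h))
    have h2 : |a i - a j| ≤ |y j - a j| + |y i - a i| := by
      have := abs_sub (y j - a j) (y i - a i)
      rw [hij, show y j - a j - (y j - a i) = a i - a j by ring, ← hij] at this
      rwa [← hij]
    linarith [hy i, hy j]
  · have h1 : |a i| - |y i| ≤ |y i - a i| := by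
      rw [abs_sub_comm]
      exact abs_sub_abs_le_abs_sub _ _
    linarith [hy i, hδa i]

/-! ### Determinants of quadratic pencils -/

/-- The characteristic polynomial of the block linearization of the quadratic pencil
`z² - z T - Ψ Φ`. -/
lemma eval_charpoly_fromBlocks_linearization {n : Type*} [Fintype n] [DecidableEq n]
    (T Φ Ψ : Matrix n n ℂ) {z : ℂ} (hz : z ≠ 0) :
    (fromBlocks T ((-Complex.I) • Ψ) (Complex.I • Φ) 0).charpoly.eval z =
      (z ^ 2 • (1 : Matrix n n ℂ) - z • T - Ψ * Φ).det := by
  have h1 : scalar (n ⊕ n) z - fromBlocks T ((-Complex.I) • Ψ) (Complex.I • Φ) 0 =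
      fromBlocks (z • 1 - T) (Complex.I • Ψ) ((-Complex.I) • Φ) (z • (1 : Matrix n n ℂ)) := by
    ext (i | i) (j | j) <;> simp [diagonal_apply, one_apply]
  let : Invertible (z • (1 : Matrix n n ℂ)) :=
    ⟨z⁻¹ • 1, by simp [smul_smul, hz], by simp [smul_smul, hz]⟩
  have h2 : ⅟(z • (1 : Matrix n n ℂ)) = z⁻¹ • 1 := rfl
  rw [eval_charpoly, h1, det_fromBlocks₂₂, h2, ← det_mul]
  congr 1
  have h3 : (Complex.I • Ψ) * (z⁻¹ • (1 : Matrix n n ℂ)) * ((-Complex.I) • Φ) =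
      z⁻¹ • (Ψ * Φ) := by
    simp only [smul_mul_assoc, mul_smul_comm, mul_one, smul_smul]
    congr 1
    linear_combination (-z⁻¹) * Complex.I_sq
  rw [h3, smul_mul_assoc, one_mul, smul_sub, smul_sub, smul_smul, smul_smul, mul_inv_cancel₀ hz,
    one_smul, sq]

/-- If the rows where `d` does not vanish are rescaled, `det (G + β diag d)` has a limit as
`β → ∞`. -/
lemma tendsto_det_add_smul_diagonal {n : Type*} [Fintype n] [DecidableEq n]
    (G : Matrix n n ℂ) (d : n → ℂ) (p : n → Prop) [DecidablePred p] (hp : ∀ i, ¬ p i → d i = 0) :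
    Tendsto (fun β : ℝ => ((β : ℂ)⁻¹) ^ Fintype.card {i // p i} *
        (G + (β : ℂ) • diagonal d).det) atTop
      (𝓝 ((∏ i : {i // p i}, d i) *
        (G.submatrix (Subtype.val : {i // ¬ p i} → n) Subtype.val).det)) := by
  let e := Equiv.sumCompl p
  let G₁₁ := G.submatrix (Subtype.val : {i // p i} → n) (Subtype.val : {i // p i} → n)
  let G₁₂ := G.submatrix (Subtype.val : {i // p i} → n) (Subtype.val : {i // ¬ p i} → n)
  let G₂₁ := G.submatrix (Subtype.val : {i // ¬ p i} → n) (Subtype.val : {i // p i} → n)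
  let G₂₂ := G.submatrix (Subtype.val : {i // ¬ p i} → n) (Subtype.val : {i // ¬ p i} → n)
  let D := diagonal (fun i : {i // p i} => d i)
  have hblock : ∀ β : ℂ, (G + β • diagonal d).submatrix e e =
      fromBlocks (G₁₁ + β • D) G₁₂ G₂₁ G₂₂ := by
    intro β
    ext (i | i) (j | j)
    · simp [e, G₁₁, D, diagonal_apply, Subtype.ext_iff]
    · have : (i : n) ≠ j := fun h => j.2 (h ▸ i.2)
      simp [e, G₁₂, this]
    · have : (i : n) ≠ j := fun h => i.2 (h ▸ j.2)
      simp [e, G₂₁, this]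
    · simp [e, G₂₂, diagonal_apply, hp i i.2]
  -- Multiplying the rows selected by `p` by `ε = β⁻¹` gives a matrix continuous in `ε`, block
  -- triangular at `ε = 0`.
  have hcont : Tendsto (fun β : ℝ => (fromBlocks ((β : ℂ)⁻¹ • G₁₁ + D) ((β : ℂ)⁻¹ • G₁₂)
      G₂₁ G₂₂).det) atTop (𝓝 ((fromBlocks D 0 G₂₁ G₂₂).det)) := by
    have hc : Continuous (fun ε : ℂ => (fromBlocks (ε • G₁₁ + D) (ε • G₁₂) G₂₁ G₂₂).det) := by
      refine Continuous.matrix_det ?_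
      refine Continuous.matrix_fromBlocks ?_ ?_ continuous_const continuous_const <;> fun_prop
    have h0 : Tendsto (fun β : ℝ => (β : ℂ)⁻¹) atTop (𝓝 0) := by
      have := (Complex.continuous_ofReal.tendsto 0).comp tendsto_inv_atTop_zero
      simpa [Function.comp_def] using this
    simpa [Function.comp_def] using (hc.tendsto 0).comp h0
  rw [det_fromBlocks_zero₁₂, det_diagonal] at hcont
  refine hcont.congr' ?_
  filter_upwards [eventually_ne_atTop 0] with β hβ
  have hβ' : (β : ℂ) ≠ 0 := by exact_mod_cast hβ
  rw [← det_submatrix_equiv_self e, hblock]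
  have h1 : fromBlocks ((β : ℂ)⁻¹ • G₁₁ + D) ((β : ℂ)⁻¹ • G₁₂) G₂₁ G₂₂ =
      fromBlocks ((β : ℂ)⁻¹ • (1 : Matrix {i // p i} {i // p i} ℂ)) 0 0 1 *
        fromBlocks (G₁₁ + (β : ℂ) • D) G₁₂ G₂₁ G₂₂ := by
    rw [fromBlocks_multiply]
    simp only [Matrix.smul_mul, Matrix.one_mul, Matrix.zero_mul, add_zero, zero_add, smul_add,
      smul_smul, inv_mul_cancel₀ hβ', one_smul]
  rw [h1, det_mul, det_fromBlocks_zero₂₁]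
  simp

/-- A gyroscopic pencil without dissipation has only real, nonzero frequencies. -/
lemma exists_real_frequencies {n : Type*} [Fintype n] [DecidableEq n] {T Φ : Matrix n n ℂ}
    (hT : T.IsHermitian) (hΦ : IsUnit Φ.det) :
    ∃ ρ : n ⊕ n → ℝ, (∀ j, ρ j ≠ 0) ∧ ∀ z : ℂ, z ≠ 0 →
      (z ^ 2 • (1 : Matrix n n ℂ) - z • T - Φᴴ * Φ).det = ∏ j, (z - (ρ j : ℂ)) := by
  -- The linearization is Hermitian, and invertible because `Φ` is, so the frequencies are its real
  -- nonzero eigenvalues.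
  let W := fromBlocks T ((-Complex.I) • Φᴴ) (Complex.I • Φ) 0
  have hW : W.IsHermitian := by
    simp [W, IsHermitian, fromBlocks_conjTranspose, hT.eq, conjTranspose_smul]
  have hdet : W.det ≠ 0 := by
    have hΦ' : IsUnit (Φᴴ).det := by
      rw [det_conjTranspose]
      exact hΦ.star
    have : W * fromBlocks 0 ((-Complex.I) • Φ⁻¹) (Complex.I • (Φᴴ)⁻¹)
        (-((Φᴴ)⁻¹ * T * Φ⁻¹)) = 1 := by
      rw [fromBlocks_multiply, ← fromBlocks_one]
      congr 1
      · simp [smul_smul, mul_nonsing_inv _ hΦ']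
      · rw [mul_neg, mul_smul_comm, smul_mul_assoc, ← mul_assoc, ← mul_assoc,
          mul_nonsing_inv _ hΦ']
        simp
      · simp
      · rw [mul_smul_comm, smul_mul_assoc, smul_smul, mul_nonsing_inv _ hΦ]
        simp
    have h2 := congrArg det this
    rw [det_mul, det_one] at h2
    exact left_ne_zero_of_mul_eq_one h2
  refine ⟨hW.eigenvalues, fun j hj => hdet ?_, fun z hz => ?_⟩
  · rw [hW.det_eq_prod_eigenvalues]
    exact Finset.prod_eq_zero (Finset.mem_univ j) (by simp [hj])
  · rw [← eval_charpoly_fromBlocks_linearization T Φ Φᴴ hz]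
    change W.charpoly.eval z = _
    rw [hW.charpoly_eq, Polynomial.eval_prod]
    simp

/-- If some of the `z j` exhaust pairwise distinct purely imaginary numbers `i y`, in number at
least that of the indices `j ∈ J`, then all `z j`, `j ∈ J`, are purely imaginary. -/
lemma re_eq_zero_of_injective {κ ι : Type*} [Fintype ι] {z : κ → ℂ} {J : Finset κ} {y : ι → ℝ}
    (hy : Function.Injective y) (hcard : J.card ≤ Fintype.card ι)
    (h : ∀ i, ∃ j ∈ J, z j = Complex.I * y i) : ∀ j ∈ J, (z j).re = 0 := by
  classical
  choose f hfJ hf using h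
  have hinj : Function.Injective f := by
    intro a b hab
    have := hf a
    rw [hab, hf b] at this
    exact hy (by simpa using this.symm)
  have himg : Finset.univ.image f = J := by
    refine Finset.eq_of_subset_of_card_le (fun j hj => ?_) ?_
    · obtain ⟨i, -, rfl⟩ := Finset.mem_image.mp hj
      exact hfJ i
    · rwa [Finset.card_image_of_injective _ hinj]
  intro j hj
  rw [← himg] at hj
  obtain ⟨i, -, rfl⟩ := Finset.mem_image.mp hj
  simp [hf]

namespace LagrangianSystem

variable {N : ℕ}

/-! ### Normalized coordinates and the characteristic polynomial of the system operator -/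

lemma transpose_sqrt {n : Type*} [Fintype n] [DecidableEq n] (M : Matrix n n ℝ) :
    (CFC.sqrt M)ᵀ = CFC.sqrt M := by
  have := (nonneg_iff_posSemidef.mp (CFC.sqrt_nonneg M)).isHermitian.eq
  rwa [conjTranspose_eq_transpose_of_trivial] at this

lemma Kp_mul_α_mul_transpose (S : LagrangianSystem N) : S.Kp * S.α * S.Kpᵀ = 1 := by
  have hs : CFC.sqrt S.α * CFC.sqrt S.α = S.α :=
    CFC.sqrt_mul_sqrt_self S.α (nonneg_iff_posSemidef.mpr S.posDef_α.posSemidef)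
  have hu : IsUnit (CFC.sqrt S.α).det := by
    have h1 := congrArg det hs
    rw [det_mul] at h1
    refine isUnit_iff_ne_zero.mpr fun h0 => S.posDef_α.det_pos.ne' ?_
    rw [← h1, h0, zero_mul]
  have ht : S.Kpᵀ = S.Kp := by
    rw [Kp, transpose_nonsing_inv, transpose_sqrt]
  rw [ht, Kp]
  nth_rw 2 [← hs]
  rw [← mul_assoc, nonsing_inv_mul _ hu, one_mul, mul_nonsing_inv _ hu]

lemma Phi_transpose_mul_Phi (S : LagrangianSystem N) :
    S.Phiᵀ * S.Phi = S.Kp * S.η * S.Kpᵀ := by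
  have hs : CFC.sqrt S.η * CFC.sqrt S.η = S.η :=
    CFC.sqrt_mul_sqrt_self S.η (nonneg_iff_posSemidef.mpr S.posSemidef_η)
  rw [Phi, Kq, transpose_mul, transpose_transpose, transpose_sqrt]
  conv_rhs => rw [← hs]
  simp only [mul_assoc]

/-- The loss matrix `K_p R K_pᵀ` in the normalized coordinates. -/
def loss (S : LagrangianSystem N) : Matrix (Fin N) (Fin N) ℝ := S.Kp * S.R * S.Kpᵀ

lemma posSemidef_loss (S : LagrangianSystem N) : S.loss.PosSemidef := by
  have := S.posSemidef_R.mul_mul_conjTranspose_same S.Kp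
  rwa [conjTranspose_eq_transpose_of_trivial] at this

/-- The eigenvalues of the normalized loss matrix, with multiplicity. -/
def lossEigenvalues (S : LagrangianSystem N) : Fin N → ℝ :=
  S.posSemidef_loss.isHermitian.eigenvalues

lemma isUnit_det_of_mul_mul_transpose {V M : Matrix (Fin N) (Fin N) ℝ}
    (hV : V * M * Vᵀ = 1) : IsUnit V.det := by
  have := congrArg det hV
  rw [det_mul, det_mul, det_one, mul_assoc] at this
  exact IsUnit.of_mul_eq_one _ this

lemma card_lossEigenvalues_ne_zero (S : LagrangianSystem N) :
    Fintype.card {i // S.lossEigenvalues i ≠ 0} = S.NR := by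
  have h := S.posSemidef_loss.isHermitian.rank_eq_card_non_zero_eigs
  have hK := isUnit_det_of_mul_mul_transpose S.Kp_mul_α_mul_transpose
  rw [NR, lossEigenvalues, ← h, loss, rank_mul_eq_left_of_isUnit_det,
    rank_mul_eq_right_of_isUnit_det _ _ hK]
  rwa [det_transpose]

/-- Simultaneous diagonalization of `α` and `R`. -/
lemma exists_simultaneous_diagonalization (S : LagrangianSystem N) :
    ∃ V : Matrix (Fin N) (Fin N) ℝ, V * S.α * Vᵀ = 1 ∧
      V * S.R * Vᵀ = diagonal S.lossEigenvalues := by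
  have hH := S.posSemidef_loss.isHermitian
  let U : Matrix (Fin N) (Fin N) ℝ := hH.eigenvectorUnitary
  have hUU : Uᵀ * U = 1 := by
    have := Unitary.coe_star_mul_self hH.eigenvectorUnitary
    rwa [star_eq_conjTranspose, conjTranspose_eq_transpose_of_trivial] at this
  have hd : Uᵀ * S.loss * U = diagonal S.lossEigenvalues := by
    have h1 : S.loss = U * diagonal S.lossEigenvalues * Uᵀ := by
      have := hH.spectral_theorem
      rw [Unitary.conjStarAlgAut_apply, star_eq_conjTranspose,
        conjTranspose_eq_transpose_of_trivial] at this
      exact this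
    calc Uᵀ * S.loss * U = (Uᵀ * U) * diagonal S.lossEigenvalues * (Uᵀ * U) := by
          rw [h1]; simp only [mul_assoc]
      _ = _ := by rw [hUU, one_mul, mul_one]
  refine ⟨Uᵀ * S.Kp, ?_, ?_⟩
  · calc Uᵀ * S.Kp * S.α * (Uᵀ * S.Kp)ᵀ = Uᵀ * (S.Kp * S.α * S.Kpᵀ) * U := by
          rw [transpose_mul, transpose_transpose]; simp only [mul_assoc]
      _ = 1 := by rw [Kp_mul_α_mul_transpose, mul_one, hUU]
  · rw [← hd, loss, transpose_mul, transpose_transpose]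
    simp only [mul_assoc]

/-- The characteristic polynomial of the system operator in terms of the quadratic pencil, in any
coordinates that normalize `α`. -/
lemma eval_charpoly_A (S : LagrangianSystem N) {V : Matrix (Fin N) (Fin N) ℝ}
    (hV : V * S.α * Vᵀ = 1) (β : ℝ) {z : ℂ} (hz : z ≠ 0) :
    (S.A β).charpoly.eval z =
      (z ^ 2 • (1 : Matrix (Fin N) (Fin N) ℂ) +
        (Complex.I * z) • ((2 : ℝ) • (V * S.θ * Vᵀ) + β • (V * S.R * Vᵀ)).map Complex.ofReal -
        (V * S.η * Vᵀ).map Complex.ofReal).det := by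
  let c : Matrix (Fin N) (Fin N) ℝ →+* Matrix (Fin N) (Fin N) ℂ := Complex.ofRealHom.mapMatrix
  have hc : ∀ M, M.map Complex.ofReal = c M := fun M => rfl
  have hcs : ∀ (a : ℝ) M, c (a • M) = (a : ℂ) • c M := by
    intro a M
    ext i j
    simp [c]
  let M : Matrix (Fin N) (Fin N) ℂ := z ^ 2 • c S.α +
    (Complex.I * z) • c ((2 : ℝ) • S.θ + β • S.R) - c S.η
  -- The determinant is the same for every `W` normalizing `α`, since `det W * det Wᵀ * det α = 1`.
  -- This permits passing from `V` to `K_p`, where the block form of `A β` applies.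
  have hM : ∀ W : Matrix (Fin N) (Fin N) ℝ, W * S.α * Wᵀ = 1 →
      (z ^ 2 • (1 : Matrix (Fin N) (Fin N) ℂ) +
        (Complex.I * z) • ((2 : ℝ) • (W * S.θ * Wᵀ) + β • (W * S.R * Wᵀ)).map Complex.ofReal -
        (W * S.η * Wᵀ).map Complex.ofReal).det * (c S.α).det = M.det := by
    intro W hW
    have h1 : z ^ 2 • (1 : Matrix (Fin N) (Fin N) ℂ) +
        (Complex.I * z) • ((2 : ℝ) • (W * S.θ * Wᵀ) + β • (W * S.R * Wᵀ)).map Complex.ofReal -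
        (W * S.η * Wᵀ).map Complex.ofReal = c W * M * c Wᵀ := by
      rw [← map_one c, ← hW, hc, hc]
      simp only [M, map_add, map_mul, hcs]
      simp only [mul_add, mul_sub, add_mul, sub_mul, mul_smul_comm, smul_mul_assoc]
    have h2 : (c W).det * (c Wᵀ).det * (c S.α).det = 1 := by
      have := congrArg (fun X => (c X).det) hW
      simp only [map_mul, map_one, det_mul, det_one] at this
      linear_combination this
    rw [h1, det_mul, det_mul]
    linear_combination M.det * h2
  have hα : (c S.α).det ≠ 0 := by
    have : (c S.α).det = ((S.α.det : ℝ) : ℂ) := (RingHom.map_det Complex.ofRealHom S.α).symm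
    rw [this]
    exact_mod_cast S.posDef_α.det_pos.ne'
  refine mul_right_cancel₀ hα ?_
  rw [hM V hV, ← hM S.Kp S.Kp_mul_α_mul_transpose]
  congr 1
  have hA : S.A β = fromBlocks ((-Complex.I) • c ((2 : ℝ) • (S.Kp * S.θ * S.Kpᵀ) +
      β • (S.Kp * S.R * S.Kpᵀ))) ((-Complex.I) • c S.Phiᵀ) (Complex.I • c S.Phi) 0 := by
    rw [A, Omega, B, fromBlocks_smul, sub_eq_add_neg, fromBlocks_neg, fromBlocks_add]
    simp only [hc, smul_zero, neg_zero, add_zero, map_add, hcs, smul_add, smul_smul]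
    congr 1
    rw [← neg_smul]
    push_cast
    ring_nf
  rw [hA, eval_charpoly_fromBlocks_linearization _ _ _ hz, ← map_mul, Phi_transpose_mul_Phi,
    hc, hc, smul_smul, sub_eq_add_neg (z ^ 2 • (1 : Matrix (Fin N) (Fin N) ℂ)), ← neg_smul]
  congr 4
  ring

/-- The real quadratic pencil of the system. -/
def pencil (S : LagrangianSystem N) (β t : ℝ) : Matrix (Fin N) (Fin N) ℝ :=
  t ^ 2 • S.α + t • ((2 : ℝ) • S.θ + β • S.R) + S.η

/-- At `z = i t` the complex pencil becomes minus the real one, so overdamped modes can be found by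
real-variable methods. -/
lemma isRoot_charpoly_A (S : LagrangianSystem N) (β : ℝ) {t : ℝ} (ht : t ≠ 0)
    (hdet : (S.pencil β t).det = 0) : (S.A β).charpoly.IsRoot (Complex.I * t) := by
  have hz : Complex.I * (t : ℂ) ≠ 0 := by simp [ht]
  rw [Polynomial.IsRoot, S.eval_charpoly_A S.Kp_mul_α_mul_transpose β hz]
  let c : Matrix (Fin N) (Fin N) ℝ →+* Matrix (Fin N) (Fin N) ℂ := Complex.ofRealHom.mapMatrix
  have hc : ∀ M, M.map Complex.ofReal = c M := fun M => rfl
  have hcs : ∀ (a : ℝ) M, c (a • M) = (a : ℂ) • c M := by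
    intro a M
    ext i j
    simp [c]
  have h1 : (Complex.I * (t : ℂ)) ^ 2 • (1 : Matrix (Fin N) (Fin N) ℂ) +
        (Complex.I * (Complex.I * t)) • ((2 : ℝ) • (S.Kp * S.θ * S.Kpᵀ) +
          β • (S.Kp * S.R * S.Kpᵀ)).map Complex.ofReal -
        (S.Kp * S.η * S.Kpᵀ).map Complex.ofReal = -(c (S.Kp * S.pencil β t * S.Kpᵀ)) := by
    rw [← map_one c, ← S.Kp_mul_α_mul_transpose, hc, hc, pencil]
    have e1 : (Complex.I * (t : ℂ)) ^ 2 = ((-(t ^ 2) : ℝ) : ℂ) := by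
      rw [mul_pow, Complex.I_sq]; push_cast; ring
    have e2 : Complex.I * (Complex.I * (t : ℂ)) = ((-t : ℝ) : ℂ) := by
      rw [← mul_assoc, Complex.I_mul_I]; push_cast; ring
    rw [e1, e2, ← hcs, ← hcs, ← map_add, ← map_sub, ← map_neg]
    congr 1
    simp only [mul_add, add_mul, mul_smul_comm, smul_mul_assoc, smul_add, neg_smul]
    abel
  have h2 : (S.Kp * S.pencil β t * S.Kpᵀ).det = 0 := by
    rw [det_mul, det_mul, hdet]
    simp
  have h3 : (c (S.Kp * S.pencil β t * S.Kpᵀ)).det =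
      (((S.Kp * S.pencil β t * S.Kpᵀ).det : ℝ) : ℂ) :=
    (RingHom.map_det Complex.ofRealHom _).symm
  rw [h1, det_neg, h3, h2]
  simp

/-- Under the generic condition the nonzero eigenvalues of the loss matrix are simple. -/
lemma Generic.eigenvalues_injective {S : LagrangianSystem N} (hS : S.Generic) :
    Function.Injective (fun i : {i // S.lossEigenvalues i ≠ 0} => S.lossEigenvalues i) := by
  intro i j hij
  by_contra hne
  have hne' : (i : Fin N) ≠ j := fun h => hne (Subtype.ext h)
  let b := S.posSemidef_loss.isHermitian.eigenvectorBasis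
  -- Eigenvectors of the loss matrix, padded by zero, are eigenvectors of `B`; they lie in its range
  -- when the eigenvalue is nonzero. Two with equal eigenvalue would give geometric multiplicity at
  -- least `2`, hence a repeated root.
  let v : Fin N → EuclideanSpace ℂ (Fin N ⊕ Fin N) := fun k =>
    WithLp.toLp 2 (Sum.elim (fun m => ((b k m : ℝ) : ℂ)) 0)
  have hv : ∀ k, S.Bop (v k) = (S.lossEigenvalues k : ℂ) • v k := by
    intro k
    have h1 : ∀ m, ∑ x, (S.Kp * S.R * S.Kpᵀ) m x * b k x = S.lossEigenvalues k * b k m := fun m =>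
      congrFun (S.posSemidef_loss.isHermitian.mulVec_eigenvectorBasis k) m
    have h2 : S.Bop (v k) = WithLp.toLp 2 (S.B *ᵥ Sum.elim (fun m => ((b k m : ℝ) : ℂ)) 0) := rfl
    rw [h2, B, fromBlocks_mulVec]
    ext (m | m)
    · have h3 := congrArg Complex.ofReal (h1 m)
      push_cast at h3
      simpa [v, mulVec, dotProduct] using h3
    · simp [v]
  have hmem : ∀ k, S.lossEigenvalues k ≠ 0 → v k ∈ S.HB := by
    intro k hk
    refine ⟨(S.lossEigenvalues k : ℂ)⁻¹ • v k, ?_⟩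
    rw [map_smul, hv, smul_smul, inv_mul_cancel₀ (by exact_mod_cast hk), one_smul]
  have heig : ∀ k (hk : S.lossEigenvalues k ≠ 0),
      S.B2 ⟨v k, hmem k hk⟩ = (S.lossEigenvalues k : ℂ) • ⟨v k, hmem k hk⟩ := by
    intro k hk
    have : S.B2 ⟨v k, hmem k hk⟩ = S.HB.orthogonalProjectionOnto (S.Bop (v k)) := rfl
    rw [this, hv, map_smul]
    congr 1
    exact Submodule.orthogonalProjectionOnto_mem_subspace_eq_self (K := S.HB) ⟨v k, hmem k hk⟩
  let μ : ℂ := S.lossEigenvalues i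
  have hcount : Module.finrank ℂ (Module.End.eigenspace S.B2 μ) ≤ 1 := by
    refine (LinearMap.finrank_eigenspace_le S.B2 μ).trans ?_
    rw [← Polynomial.count_roots]
    exact Multiset.nodup_iff_count_le_one.mp hS μ
  let w : Fin 2 → Module.End.eigenspace S.B2 μ :=
    ![⟨⟨v i, hmem i i.2⟩, Module.End.mem_eigenspace_iff.mpr (heig i i.2)⟩,
      ⟨⟨v j, hmem j j.2⟩, Module.End.mem_eigenspace_iff.mpr (by
        have hij' : S.lossEigenvalues i = S.lossEigenvalues j := hij
        rw [heig j j.2]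
        simp only [μ, hij'])⟩]
  have hw : LinearIndependent ℂ w := by
    rw [LinearIndependent.pair_iff]
    intro s t hst
    have hst' : s • v i + t • v j = 0 := by
      have := congrArg (fun x : Module.End.eigenspace S.B2 μ =>
        ((x : S.HB) : EuclideanSpace ℂ (Fin N ⊕ Fin N))) hst
      simpa using this
    have hk : ∀ m, s * (b i m : ℝ) + t * (b j m : ℝ) = 0 := by
      intro m
      have := congrArg (fun x : EuclideanSpace ℂ (Fin N ⊕ Fin N) => x (Sum.inl m)) hst'
      simpa [v] using this
    have horth : ∀ k l, ∑ m, b k m * b l m = if k = l then (1 : ℝ) else 0 := by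
      intro k l
      have := orthonormal_iff_ite.mp b.orthonormal l k
      rw [PiLp.inner_apply] at this
      simpa [eq_comm] using this
    have hort : ∀ k l, ∑ m, ((b k m : ℝ) : ℂ) * (b l m : ℝ) = if k = l then (1 : ℂ) else 0 := by
      intro k l
      have := congrArg Complex.ofReal (horth k l)
      rw [apply_ite Complex.ofReal] at this
      simpa using this
    have key : ∀ k : Fin N, s * (if (i : Fin N) = k then 1 else 0) +
        t * (if (j : Fin N) = k then 1 else 0) = 0 := by
      intro k
      rw [← hort, ← hort, Finset.mul_sum, Finset.mul_sum, ← Finset.sum_add_distrib]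
      refine Finset.sum_eq_zero fun m _ => ?_
      linear_combination (b k m : ℂ) * hk m
    exact ⟨by simpa [hne'.symm] using key i, by simpa [hne'] using key j⟩
  have := hw.fintype_card_le_finrank
  rw [Fintype.card_fin] at this
  omega

end LagrangianSystem

lemma exists_equiv_sum_sum {n : ℕ} {A B C : Type*} [Fintype A] [Fintype B] [Fintype C]
    (h : n = Fintype.card A + (Fintype.card B + Fintype.card C)) :
    ∃ e : Fin n ≃ A ⊕ (B ⊕ C), ∀ j : Fin n,
      ((j : ℕ) < Fintype.card A → ∃ a, e j = Sum.inl a) ∧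
      (Fintype.card A ≤ j → (j : ℕ) < Fintype.card A + Fintype.card B →
        ∃ b, e j = Sum.inr (Sum.inl b)) ∧
      (Fintype.card A + Fintype.card B ≤ j → ∃ c, e j = Sum.inr (Sum.inr c)) := by
  let e : Fin n ≃ A ⊕ (B ⊕ C) := (finCongr h).trans (finSumFinEquiv.symm.trans
    (Equiv.sumCongr (Fintype.equivFin A).symm (finSumFinEquiv.symm.trans
      (Equiv.sumCongr (Fintype.equivFin B).symm (Fintype.equivFin C).symm))))
  refine ⟨e, fun j => ?_⟩
  obtain ⟨x, rfl⟩ := e.symm.surjective j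
  rw [Equiv.apply_symm_apply]
  rcases x with a | b | c
  · have h1 : (e.symm (Sum.inl a) : ℕ) = Fintype.equivFin A a := by simp [e]
    have h2 := (Fintype.equivFin A a).isLt
    refine ⟨fun _ => ⟨a, rfl⟩, fun h => ?_, fun h => ?_⟩ <;> omega
  · have h1 : (e.symm (Sum.inr (Sum.inl b)) : ℕ) = Fintype.card A + Fintype.equivFin B b := by
      simp [e]
    have h2 := (Fintype.equivFin B b).isLt
    refine ⟨fun h => ?_, fun _ _ => ⟨b, rfl⟩, fun h => ?_⟩ <;> omega
  · have h1 : (e.symm (Sum.inr (Sum.inr c)) : ℕ) =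
        Fintype.card A + (Fintype.card B + Fintype.equivFin C c) := by
      simp [e]
    refine ⟨fun h => ?_, fun _ h => ?_, fun _ => ⟨c, rfl⟩⟩ <;> omega

/-! ### Large real zeros of the pencil, and duality -/

namespace LagrangianSystem

variable {N : ℕ}

/-- Under the generic condition the pencil has, for large losses, as many distinct large real
zeros as the rank of `R`. -/
lemma Generic.eventually_exists_large_zeros {S : LagrangianSystem N} (hS : S.Generic) :
    ∃ c > 0, ∀ᶠ β : ℝ in atTop, ∃ y : {i // S.lossEigenvalues i ≠ 0} → ℝ,
      Function.Injective y ∧ ∀ i, (S.pencil β (y i)).det = 0 ∧ c * β ≤ |y i| := by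
  obtain ⟨V, hα, hR⟩ := S.exists_simultaneous_diagonalization
  have hVu := isUnit_det_of_mul_mul_transpose hα
  set d := S.lossEigenvalues with hd
  -- This is the pencil at `β t`, divided by `β²`, with `ε = β⁻¹`; at `ε = 0` it is diagonal.
  let P : ℝ → ℝ → Matrix (Fin N) (Fin N) ℝ := fun ε t =>
    t ^ 2 • 1 + t • ((2 * ε) • (V * S.θ * Vᵀ) + diagonal d) + ε ^ 2 • (V * S.η * Vᵀ)
  have hg : ∀ t, (P 0 t).det = ∏ i, (t * (t + d i)) := by
    intro t
    have : P 0 t = diagonal (fun i => t * (t + d i)) := by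
      ext i j
      by_cases hij : i = j
      · subst hij
        simp [P]
        ring
      · simp [P, hij]
    rw [this, det_diagonal]
  obtain ⟨c, hc, hev⟩ := eventually_exists_zeros (l := atTop)
    (f := fun β t => (P β⁻¹ t).det) (g := fun t => (P 0 t).det)
    (a := fun i : {i // d i ≠ 0} => -d i)
    (fun β => Continuous.matrix_det (by fun_prop))
    (fun t => by
      have hcont : Continuous fun ε => (P ε t).det := Continuous.matrix_det (by fun_prop)
      exact (hcont.tendsto 0).comp tendsto_inv_atTop_zero)
    (fun i j hij => hS.eigenvalues_injective (neg_injective hij))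
    (fun i => neg_ne_zero.mpr i.2)
    (fun i => by
      -- The cofactor of `t + d i` is nonzero at `-d i`: the factors `t` because `d i ≠ 0`, the
      -- factors `t + d j` by genericity.
      refine ⟨fun t => t * ∏ j ∈ Finset.univ.erase (i : Fin N), (t * (t + d j)), ?_, ?_, ?_⟩
      · exact Continuous.continuousAt (by fun_prop)
      · refine mul_ne_zero (neg_ne_zero.mpr i.2) (Finset.prod_ne_zero_iff.mpr fun j hj => ?_)
        refine mul_ne_zero (neg_ne_zero.mpr i.2) fun h0 => ?_
        have h1 : d j = d i := by linarith
        have h2 : d j ≠ 0 := h1 ▸ i.2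
        have := hS.eigenvalues_injective (a₁ := ⟨j, h2⟩) (a₂ := i) h1
        exact Finset.ne_of_mem_erase hj (congrArg Subtype.val this)
      · intro t
        rw [hg, ← Finset.mul_prod_erase _ _ (Finset.mem_univ (i : Fin N))]
        ring)
  refine ⟨c, hc, ?_⟩
  filter_upwards [hev, eventually_gt_atTop 0] with β ⟨y, hy, hy0⟩ hβ
  refine ⟨fun i => β * y i, fun i j hij => hy (mul_left_cancel₀ hβ.ne' hij), fun i => ⟨?_, ?_⟩⟩
  · have h1 : V * S.pencil β (β * y i) * Vᵀ = β ^ 2 • P β⁻¹ (y i) := by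
      simp only [pencil, P, mul_add, add_mul, mul_smul_comm, smul_mul_assoc, hα, hR, smul_add,
        smul_smul]
      congr 1
      · congr 1
        · congr 1
          ring
        · congr 2
          · field_simp
          · ring
      · rw [← mul_pow, mul_inv_cancel₀ hβ.ne', one_pow, one_smul]
    have h2 := congrArg det h1
    rw [det_smul, (hy0 i).1, mul_zero, det_mul, det_mul, det_transpose] at h2
    have h3 := hVu.ne_zero
    simpa [h3] using h2
  · rw [abs_mul, abs_of_pos hβ, mul_comm]
    exact mul_le_mul_of_nonneg_left (hy0 i).2 hβ.le

/-- Inverting `t` reverses the order of the coefficients of the quadratic pencil, which swaps `α`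
and `η` and fixes the middle term. -/
lemma pencil_dual (S : LagrangianSystem N) (hη : S.η.PosDef) (β : ℝ) {t : ℝ} (ht : t ≠ 0) :
    S.pencil β t⁻¹ = (t⁻¹) ^ 2 • (S.dual hη).pencil β t := by
  simp only [pencil, dual, smul_add, smul_smul]
  have h1 : t⁻¹ ^ 2 * t ^ 2 = 1 := by field_simp
  have h3 : t⁻¹ ^ 2 * (t * 2) = t⁻¹ * 2 := by field_simp
  have h4 : t⁻¹ ^ 2 * (t * β) = t⁻¹ * β := by field_simp
  rw [h1, h3, h4, one_smul]
  abel

lemma card_roots_charpoly_A (S : LagrangianSystem N) (β : ℝ) :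
    (S.A β).charpoly.roots.card = 2 * N := by
  rw [Polynomial.splits_iff_card_roots.mp (IsAlgClosed.splits _), charpoly_natDegree_eq_dim]
  simp [two_mul]

lemma eval_charpoly_A_eq_prod (S : LagrangianSystem N) (β : ℝ) (z : ℂ) :
    ((S.A β).charpoly.roots.map (fun a => z - a)).prod = (S.A β).charpoly.eval z := by
  conv_rhs => rw [(IsAlgClosed.splits (S.A β).charpoly).eq_prod_roots_of_monic (charpoly_monic _)]
  simp [Polynomial.eval_multiset_prod, Multiset.map_map]

/-! ### The limit `β → ∞` and existence of a modal enumeration -/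

/-- The rescaled characteristic polynomials converge as `β → ∞`. -/
lemma exists_tendsto_eval_charpoly_A (S : LagrangianSystem N) (hη : S.η.PosDef) :
    ∃ (K : ℂ) (ρ : {i // ¬ S.lossEigenvalues i ≠ 0} ⊕ {i // ¬ S.lossEigenvalues i ≠ 0} → ℝ),
      K ≠ 0 ∧ (∀ j, ρ j ≠ 0) ∧ ∀ z : ℂ, z ≠ 0 →
      Tendsto (fun β : ℝ => ((β : ℂ)⁻¹) ^ S.NR * (S.A β).charpoly.eval z) atTop
        (𝓝 (K * (z ^ S.NR * ∏ j, (z - (ρ j : ℂ))))) := by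
  obtain ⟨V, hα, hR⟩ := S.exists_simultaneous_diagonalization
  have hVu := isUnit_det_of_mul_mul_transpose hα
  set d := S.lossEigenvalues with hd
  -- Only the directions without loss survive in the limiting determinant; `H` is the stiffness
  -- restricted to them, and still positive definite.
  let σ : {i // ¬ d i ≠ 0} → Fin N := Subtype.val
  let H : Matrix {i // ¬ d i ≠ 0} {i // ¬ d i ≠ 0} ℝ := (V * S.η * Vᵀ).submatrix σ σ
  have hH : H.PosDef := by
    refine PosDef.submatrix ?_ Subtype.val_injective
    have h1 := S.posSemidef_η.mul_mul_conjTranspose_same V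
    rw [conjTranspose_eq_transpose_of_trivial] at h1
    rw [h1.posDef_iff_det_ne_zero, det_mul, det_mul, det_transpose]
    exact mul_ne_zero (mul_ne_zero hVu.ne_zero hη.det_pos.ne') hVu.ne_zero
  let Φ : Matrix {i // ¬ d i ≠ 0} {i // ¬ d i ≠ 0} ℂ := (CFC.sqrt H).map Complex.ofReal
  have hs : CFC.sqrt H * CFC.sqrt H = H :=
    CFC.sqrt_mul_sqrt_self H (nonneg_iff_posSemidef.mpr hH.posSemidef)
  have hst : (CFC.sqrt H)ᵀ = CFC.sqrt H := transpose_sqrt H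
  have hΦΦ : Φᴴ * Φ = H.map Complex.ofReal := by
    have h1 : Φᴴ = Φ := by
      ext i j
      have := congrFun (congrFun hst i) j
      simp only [transpose_apply] at this
      simp [Φ, this]
    have h2 : (CFC.sqrt H * CFC.sqrt H).map Complex.ofReal = Φ * Φ :=
      map_mul Complex.ofRealHom.mapMatrix _ _
    rw [h1, ← h2, hs]
  have hΦ : IsUnit Φ.det := by
    have h1 : Φ.det = ((CFC.sqrt H).det : ℝ) := (RingHom.map_det Complex.ofRealHom _).symm
    have h2 := congrArg det hs
    rw [det_mul] at h2
    rw [h1, isUnit_iff_ne_zero]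
    intro h0
    have h0' : (CFC.sqrt H).det = 0 := by exact_mod_cast h0
    exact hH.det_pos.ne' (by rw [← h2, h0', zero_mul])
  let T : Matrix {i // ¬ d i ≠ 0} {i // ¬ d i ≠ 0} ℂ :=
    (-(2 * Complex.I)) • ((V * S.θ * Vᵀ).submatrix σ σ).map Complex.ofReal
  have hT : T.IsHermitian := by
    have h1 : (V * S.θ * Vᵀ)ᵀ = -(V * S.θ * Vᵀ) := by
      rw [transpose_mul, transpose_mul, transpose_transpose, S.skew_θ]
      simp [mul_assoc]
    ext i j
    have := congrFun (congrFun h1 (σ i)) (σ j)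
    simp only [transpose_apply, Matrix.neg_apply] at this
    simp [T, this]
  obtain ⟨ρ, hρ, hdet⟩ := exists_real_frequencies hT hΦ
  refine ⟨∏ i : {i // d i ≠ 0}, (Complex.I * d i), ρ, ?_, hρ, fun z hz => ?_⟩
  · refine Finset.prod_ne_zero_iff.mpr fun i _ => mul_ne_zero Complex.I_ne_zero ?_
    exact_mod_cast i.2
  let G : Matrix (Fin N) (Fin N) ℂ := z ^ 2 • (1 : Matrix (Fin N) (Fin N) ℂ) +
    (Complex.I * z) • ((2 : ℝ) • (V * S.θ * Vᵀ)).map Complex.ofReal -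
    (V * S.η * Vᵀ).map Complex.ofReal
  have h1 := tendsto_det_add_smul_diagonal G (fun i => Complex.I * z * d i) (fun i => d i ≠ 0)
    (fun i hi => by simp [not_not.mp hi])
  have hGs : G.submatrix (Subtype.val : {i // ¬ d i ≠ 0} → Fin N) Subtype.val =
      z ^ 2 • 1 - z • T - Φᴴ * Φ := by
    rw [hΦΦ]
    ext i j
    simp [G, T, H, σ, one_apply, Subtype.ext_iff]
    ring
  have hcard : Fintype.card {i // d i ≠ 0} = S.NR := S.card_lossEigenvalues_ne_zero
  have hprod : ∏ i : {i // d i ≠ 0}, (Complex.I * z * d i) =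
      (∏ i : {i // d i ≠ 0}, (Complex.I * d i)) * z ^ S.NR := by
    rw [← hcard, ← Finset.card_univ, ← Finset.prod_const, ← Finset.prod_mul_distrib]
    exact Finset.prod_congr rfl fun i _ => by ring
  rw [hGs, hdet z hz, hprod, hcard, mul_assoc] at h1
  refine h1.congr fun β => ?_
  rw [S.eval_charpoly_A hα β hz, hR]
  congr 2
  ext i j
  by_cases hij : i = j
  · subst hij
    simp [G]
    ring
  · simp [G, hij]

lemma exists_isModalEnumeration (S : LagrangianSystem N) (hη : S.η.PosDef) :
    ∃ ζ : Fin (2 * N) → ℝ → ℂ, S.IsModalEnumeration ζ := by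
  obtain ⟨K, ρ, hK, hρ, hlim⟩ := S.exists_tendsto_eval_charpoly_A hη
  have hcard : Fintype.card {i // S.lossEigenvalues i ≠ 0} = S.NR := S.card_lossEigenvalues_ne_zero
  have hN : 2 * N = Fintype.card {i // S.lossEigenvalues i ≠ 0} +
      (Fintype.card {i // S.lossEigenvalues i ≠ 0} +
        Fintype.card ({i // ¬ S.lossEigenvalues i ≠ 0} ⊕ {i // ¬ S.lossEigenvalues i ≠ 0})) := by
    have h1 := Fintype.card_congr (Equiv.sumCompl (fun i => S.lossEigenvalues i ≠ 0))
    rw [Fintype.card_sum, Fintype.card_fin] at h1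
    rw [Fintype.card_sum]
    omega
  -- The zero branch of the limit accounts for `z ^ N_R`. The point `0` is excluded because the
  -- pencil formula needs `z ≠ 0`; `q = i` works because all limits are real.
  obtain ⟨ζ, hζ, hinl, hinr⟩ := exists_enumeration_of_tendsto (ι := {i // S.lossEigenvalues i ≠ 0})
    (κ := {i // S.lossEigenvalues i ≠ 0} ⊕
      ({i // ¬ S.lossEigenvalues i ≠ 0} ⊕ {i // ¬ S.lossEigenvalues i ≠ 0}))
    (l := (atTop : Filter ℝ))
    (s := fun β => (S.A β).charpoly.roots)
    (fun β => by rw [card_roots_charpoly_A, Fintype.card_sum]; exact hN)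
    (Sum.elim (fun _ => 0) (fun j => (ρ j : ℂ))) (c := fun β => ((β : ℂ)⁻¹) ^ S.NR) hK
    (F := {0}) (q := Complex.I) (by simp)
    (by
      rintro (j | j)
      · simpa using Complex.I_ne_zero.symm
      · intro h
        simpa using congrArg Complex.im h)
    (fun z hz => by
      have h1 := hlim z (by simpa using hz)
      simp only [eval_charpoly_A_eq_prod]
      rw [Fintype.prod_sum_type]
      simpa only [Sum.elim_inl, Sum.elim_inr, sub_zero, Finset.prod_const, Finset.card_univ,
        hcard] using h1)
  obtain ⟨e, he⟩ := exists_equiv_sum_sum hN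
  rw [hcard] at he
  refine ⟨fun j => ζ (e j), ?_, fun j hj => ?_, fun j hj hj' => ?_, fun j hj => ?_⟩
  · refine Eventually.of_forall fun β => ?_
    rw [hζ β, ← Finset.map_univ_equiv e, Finset.map_val, Multiset.map_map]
    rfl
  · obtain ⟨i, hi⟩ := (he j).1 hj
    simpa [hi] using hinl i
  · obtain ⟨i, hi⟩ := (he j).2.1 hj (by omega)
    simpa [hi] using hinr (Sum.inl i)
  · obtain ⟨i, hi⟩ := (he j).2.2 (by omega)
    exact ⟨ρ i, hρ i, by simpa [hi] using hinr (Sum.inr i)⟩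

/-! ### Matching the imaginary eigenvalues with the groups of modes -/

lemma IsModalEnumeration.exists_eq_of_isRoot {S : LagrangianSystem N} {ζ : Fin (2 * N) → ℝ → ℂ}
    {β : ℝ} (h : (S.A β).charpoly.roots =
      (Finset.univ : Finset (Fin (2 * N))).val.map (fun j => ζ j β))
    {z : ℂ} (hz : (S.A β).charpoly.IsRoot z) : ∃ j, ζ j β = z := by
  have : z ∈ (S.A β).charpoly.roots :=
    (Polynomial.mem_roots (charpoly_monic _).ne_zero).mpr hz
  rw [h] at this
  obtain ⟨j, -, hj⟩ := Multiset.mem_map.mp this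
  exact ⟨j, hj⟩

/-- The high-loss modes are eventually overdamped. -/
lemma IsModalEnumeration.eventually_re_eq_zero_of_high_loss {S : LagrangianSystem N}
    {ζ : Fin (2 * N) → ℝ → ℂ} (hζ : S.IsModalEnumeration ζ) (hS : S.Generic) :
    ∀ᶠ β : ℝ in atTop, ∀ j : Fin (2 * N), (j : ℕ) < S.NR → (ζ j β).re = 0 := by
  obtain ⟨c, hc, hy⟩ := hS.eventually_exists_large_zeros
  -- Modes outside the high-loss group converge, hence stay bounded and cannot equal a zero of size
  -- at least `c β`.
  have hlow : ∀ j : Fin (2 * N), ∀ᶠ β : ℝ in atTop, S.NR ≤ (j : ℕ) → ‖ζ j β‖ < c * β := by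
    intro j
    by_cases hj : S.NR ≤ (j : ℕ)
    · have hb : ∃ a : ℂ, Tendsto (ζ j) atTop (𝓝 a) := by
        by_cases hj' : (j : ℕ) < 2 * S.NR
        · exact ⟨0, hζ.low_loss_low_Q j hj hj'⟩
        · obtain ⟨ρ, -, h⟩ := hζ.low_loss_high_Q j (not_lt.mp hj')
          exact ⟨ρ, h⟩
      obtain ⟨a, ha⟩ := hb
      have h1 : ∀ᶠ β : ℝ in atTop, ‖ζ j β‖ < ‖a‖ + 1 :=
        ha.norm.eventually_lt_const (lt_add_one _)
      have h2 : ∀ᶠ β : ℝ in atTop, ‖a‖ + 1 < c * β :=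
        (tendsto_id.const_mul_atTop hc).eventually_gt_atTop _
      filter_upwards [h1, h2] with β h1 h2 _ using h1.trans h2
    · exact Eventually.of_forall fun β h => absurd h hj
  filter_upwards [hζ.eigenvalues, hy, eventually_all.mpr hlow, eventually_gt_atTop 0]
    with β hroots ⟨y, hinj, hy⟩ hlow hβ
  have key := re_eq_zero_of_injective (z := fun j => ζ j β)
    (J := Finset.univ.filter fun j : Fin (2 * N) => (j : ℕ) < S.NR) hinj
    (by
      rw [card_lossEigenvalues_ne_zero, Fin.card_filter_val_lt]
      exact min_le_right _ _)
    (fun i => by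
      have hy0 : 0 < |y i| := (mul_pos hc hβ).trans_le (hy i).2
      obtain ⟨j, hj⟩ := exists_eq_of_isRoot hroots
        (S.isRoot_charpoly_A β (abs_pos.mp hy0) (hy i).1)
      refine ⟨j, Finset.mem_filter.mpr ⟨Finset.mem_univ j, ?_⟩, hj⟩
      by_contra hlt
      have := hlow j (not_lt.mp hlt)
      rw [hj] at this
      simp only [norm_mul, Complex.norm_I, one_mul, Complex.norm_real, Real.norm_eq_abs] at this
      exact absurd (hy i).2 (not_le.mpr this))
  exact fun j hj => key j (by simpa using hj)

/-- The low-loss/low-`Q` modes are eventually overdamped. -/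
lemma IsModalEnumeration.eventually_re_eq_zero_of_low_Q {S : LagrangianSystem N}
    {ζ : Fin (2 * N) → ℝ → ℂ} (hζ : S.IsModalEnumeration ζ) (hη : S.η.PosDef)
    (hS : (S.dual hη).Generic) :
    ∀ᶠ β : ℝ in atTop, ∀ j : Fin (2 * N), S.NR ≤ (j : ℕ) → (j : ℕ) < 2 * S.NR →
      (ζ j β).re = 0 := by
  obtain ⟨c, hc, hy⟩ := hS.eventually_exists_large_zeros
  -- Modes outside the low-Q group stay away from `0`, whereas the inverted dual zeros have size at
  -- most `(c β)⁻¹`.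
  have hbig : ∀ j : Fin (2 * N), ∀ᶠ β : ℝ in atTop,
      ((j : ℕ) < S.NR ∨ 2 * S.NR ≤ (j : ℕ)) → (c * β)⁻¹ < ‖ζ j β‖ := by
    intro j
    have h0 : Tendsto (fun β : ℝ => (c * β)⁻¹) atTop (𝓝 0) :=
      (tendsto_id.const_mul_atTop hc).inv_tendsto_atTop
    by_cases hj : (j : ℕ) < S.NR ∨ 2 * S.NR ≤ (j : ℕ)
    · have hb : ∃ a > 0, ∀ᶠ β in atTop, a < ‖ζ j β‖ := by
        rcases hj with hj | hj
        · exact ⟨1, one_pos, (hζ.high_loss j hj).eventually_gt_atTop 1⟩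
        · obtain ⟨ρ, hρ, h⟩ := hζ.low_loss_high_Q j hj
          have hρ' : 0 < ‖(ρ : ℂ)‖ := by simpa using hρ
          exact ⟨‖(ρ : ℂ)‖ / 2, by positivity, h.norm.eventually_const_lt (by linarith)⟩
      obtain ⟨a, ha, hlt⟩ := hb
      filter_upwards [hlt, h0.eventually_lt_const ha] with β h1 h2 _ using h2.trans h1
    · exact Eventually.of_forall fun β h => absurd h hj
  filter_upwards [hζ.eigenvalues, hy, eventually_all.mpr hbig, eventually_gt_atTop 0]
    with β hroots ⟨y, hinj, hy⟩ hbig hβ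
  have key := re_eq_zero_of_injective (z := fun j => ζ j β) (y := fun i => (y i)⁻¹)
    (J := Finset.univ.filter fun j : Fin (2 * N) => S.NR ≤ (j : ℕ) ∧ (j : ℕ) < 2 * S.NR)
    (fun i j hij => hinj (inv_injective hij))
    (by
      rw [card_lossEigenvalues_ne_zero]
      change _ ≤ S.NR
      have h1 : ((Finset.univ.filter fun j : Fin (2 * N) =>
          S.NR ≤ (j : ℕ) ∧ (j : ℕ) < 2 * S.NR).map Fin.valEmbedding).card ≤
          (Finset.Ico S.NR (2 * S.NR)).card := by
        refine Finset.card_le_card fun m hm => ?_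
        obtain ⟨j, hj, rfl⟩ := Finset.mem_map.mp hm
        simpa using hj
      rw [Finset.card_map, Nat.card_Ico] at h1
      omega)
    (fun i => by
      have hy0 : 0 < |y i| := (mul_pos hc hβ).trans_le (hy i).2
      have hyi : y i ≠ 0 := abs_pos.mp hy0
      have hdet : (S.pencil β (y i)⁻¹).det = 0 := by
        rw [S.pencil_dual hη β hyi, det_smul, (hy i).1, mul_zero]
      obtain ⟨j, hj⟩ := exists_eq_of_isRoot hroots
        (S.isRoot_charpoly_A β (inv_ne_zero hyi) hdet)
      refine ⟨j, Finset.mem_filter.mpr ⟨Finset.mem_univ j, ?_⟩, hj⟩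
      by_contra hlt
      have := hbig j (by omega)
      rw [hj] at this
      simp only [norm_mul, Complex.norm_I, one_mul, Complex.norm_real, Real.norm_eq_abs,
        abs_inv] at this
      exact absurd (inv_anti₀ (mul_pos hc hβ) (hy i).2) (not_le.mpr this))
  exact fun j hj hj' => key j (by simpa using ⟨hj, hj'⟩)

end LagrangianSystem

theorem mainTheorem2 {N : ℕ} (S : LagrangianSystem N) (hη : S.η.PosDef)
    (hgen : S.Generic) (hgen_dual : (S.dual hη).Generic) :
    (∃ ζ : Fin (2 * N) → ℝ → ℂ, S.IsModalEnumeration ζ) ∧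
    ∀ ζ : Fin (2 * N) → ℝ → ℂ, S.IsModalEnumeration ζ →
      (∀ᶠ β : ℝ in atTop, ∀ j : Fin (2 * N), (j : ℕ) < S.NR → (ζ j β).re = 0) ∧
      (∀ᶠ β : ℝ in atTop, ∀ j : Fin (2 * N), 2 * S.NR ≤ (j : ℕ) → (ζ j β).re ≠ 0) ∧
      (∀ j : Fin (2 * N), S.NR ≤ (j : ℕ) → (j : ℕ) < 2 * S.NR →
        Tendsto (fun β => (ζ j β).re) atTop (𝓝 0)) ∧
      (∀ᶠ β : ℝ in atTop, ∀ j : Fin (2 * N), S.NR ≤ (j : ℕ) → (j : ℕ) < 2 * S.NR →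
        (ζ j β).re = 0) := by
  refine ⟨S.exists_isModalEnumeration hη, fun ζ hζ =>
    ⟨hζ.eventually_re_eq_zero_of_high_loss hgen, ?_, fun j hj hj' => ?_,
      hζ.eventually_re_eq_zero_of_low_Q hη hgen_dual⟩⟩
  · refine eventually_all.mpr fun j => ?_
    by_cases hj : 2 * S.NR ≤ (j : ℕ)
    · obtain ⟨ρ, hρ, h⟩ := hζ.low_loss_high_Q j hj
      have h1 : Tendsto (fun β => (ζ j β).re) atTop (𝓝 ρ) := by
        simpa [Function.comp_def] using (Complex.continuous_re.tendsto _).comp h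
      filter_upwards [h1.eventually_ne hρ] with β hβ _ using hβ
    · exact Eventually.of_forall fun β h => absurd h hj
  · simpa [Function.comp_def] using
      (Complex.continuous_re.tendsto _).comp (hζ.low_loss_low_Q j hj hj')

end
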